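/- Let $Q$ be a regular local ring with maximal ideal $\mathfrak n$ and residue field $k$, let $c\ge 2$, and let $f_1,\dots,f_c\in\mathfrak n^2$ be a $Q$-regular sequence. Let $R=Q[x_1,\dots,x_c]/(f_1x_1+\cdots+f_cx_c)$ be the generic hypersurface, graded by $\deg x_i=1$ and $\deg q=0$ for $q\in Q$. A totally acyclic complex over $R$ is a $\mathbb Z$-indexed complex $C$ of finitely generated free $R$-modules with $H(C)=0=H(\operatorname{Hom}_R(C,R))$; $\mathsf{grK}_{\mathsf{tac}}(R)$ denotes the category of those totally acyclic complexes that consist of graded free modules and homogeneous differentials. A complete resolution of an $R$-module $M$ is a totally acyclic complex $C$ such that $C_{\ge i}\cong F_{\ge i}$ for some free resolution $F$ of $M$ and some $i\ge 0$. For every $\alpha\in\mathbb P^{c-1}_k$ fix preimages $a_1,\dots,a_c\in Q$ of homogeneous coordinates $\alpha_1,\dots,\alpha_c\in k$ of $\alpha$, and put $R_\alpha=R/(x_1-a_1,\dots,x_c-a_c)$ and $C_\alpha=C\otimes_RR_\alpha$. A complex $C$ of finitely generated free modules is contractible if there are maps $s_n:C_n\to C_{n+1}$ such that $\partial_{n+1}s_n+s_{n-1}\partial_n$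 is an isomorphism for all $n\in\mathbb Z$. The rank variety of $C\in\mathsf{grK}_{\mathsf{tac}}(R)$ is $$\operatorname V(C)=\{\alpha\in\mathbb P^{c-1}_k \mid C_\alpha \text{ is not contractible}\}.$$ **Proposition.** Let $K\in\mathsf{grK}_{\mathsf{tac}}(R)$ be a graded complete resolution of the graded $R$-module $R\otimes_Qk=R/\mathfrak nR\cong k[x_1,\dots,x_c]$. Then $\operatorname V(K)=\mathbb P^{c-1}_k$, for every choice of the preimages. -/

import Mathlib

open CategoryTheory IsLocalRing
open scoped TensorProduct

universe u

noncomputable section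

namespace RankVariety

/-! ### Complexes of modules -/

section Complexes

variable {R : Type u} [CommRing R]

/-- Contractibility: there are maps `s n : C n → C (n+1)` such that
`∂ (n+1) ∘ s n + s (n-1) ∘ ∂ n` is an isomorphism for all `n`. The family `s` is indexed by pairs
of integers only to avoid transports; just the members `s n (n+1)` matter. -/
def IsContractible (C : ChainComplex (ModuleCat.{u} R) ℤ) : Prop :=
  ∃ s : ∀ i j : ℤ, C.X i →ₗ[R] C.X j, ∀ n : ℤ, Function.Bijective
    ((C.d (n + 1) n).hom ∘ₗ s n (n + 1) + s (n - 1) n ∘ₗ (C.d n (n - 1)).hom)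

/-- Totally acyclic complexes: complexes of finitely generated free modules with
`H(C) = 0 = H(Hom(C, R))`. -/
structure IsTotallyAcyclic (C : ChainComplex (ModuleCat.{u} R) ℤ) : Prop where
  free : ∀ n, Module.Free R (C.X n)
  finite : ∀ n, Module.Finite R (C.X n)
  exact : ∀ n : ℤ, Function.Exact (C.d (n + 1) n).hom (C.d n (n - 1)).hom
  exact_dual : ∀ n : ℤ,
    Function.Exact (C.d n (n - 1)).hom.dualMap (C.d (n + 1) n).hom.dualMap

/-- `C` is a complete resolution of `M`: it is totally acyclic, and for some free resolution `F`
of `M` and some `i ≥ 0` the truncations `F_{≥ i}` and `C_{≥ i}` agree (up to isomorphism). -/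
def IsCompleteResolution (C : ChainComplex (ModuleCat.{u} R) ℤ) (M : ModuleCat.{u} R) : Prop :=
  IsTotallyAcyclic C ∧
  ∃ F : ProjectiveResolution M, (∀ n, Module.Free R (F.complex.X n)) ∧
  ∃ (i : ℕ) (e : ∀ n : ℕ, i ≤ n → (F.complex.X n ≅ C.X (n : ℤ))),
    ∀ (n : ℕ) (h : i ≤ n),
      (e (n + 1) (h.trans n.le_succ)).hom ≫ C.d ((n + 1 : ℕ) : ℤ) (n : ℤ) =
        F.complex.d (n + 1) n ≫ (e n h).hom

/-- The base change `C ⊗_R S` of a complex. -/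
def baseChange (S : Type u) [CommRing S] [Algebra R S]
    (C : ChainComplex (ModuleCat.{u} R) ℤ) : ChainComplex (ModuleCat.{u} S) ℤ where
  X n := ModuleCat.of S (S ⊗[R] C.X n)
  d i j := ModuleCat.ofHom ((C.d i j).hom.baseChange S)
  shape i j h := by
    rw [C.shape i j h]
    ext : 1
    exact LinearMap.baseChange_zero
  d_comp_d' i j k _ _ := by
    ext : 1
    change (C.d j k).hom.baseChange S ∘ₗ (C.d i j).hom.baseChange S = 0
    rw [← LinearMap.baseChange_comp, ← ModuleCat.hom_comp, C.d_comp_d]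
    exact LinearMap.baseChange_zero

end Complexes

/-! ### The generic hypersurface -/

section Hypersurface

variable {Q : Type u} [CommRing Q] {c : ℕ}

/-- The form `w = f₁ x₁ + ⋯ + f_c x_c` in `Q[x₁, …, x_c]`. -/
def form (f : Fin c → Q) : MvPolynomial (Fin c) Q :=
  ∑ i, MvPolynomial.C (f i) * MvPolynomial.X i

/-- The generic hypersurface `R = Q[x₁, …, x_c] / (w)`. -/
abbrev GenericHypersurface (f : Fin c → Q) : Type u :=
  MvPolynomial (Fin c) Q ⧸ Ideal.span {form f}

/-- The quotient map `Q[x₁, …, x_c] → R`. -/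
abbrev toR (f : Fin c → Q) : MvPolynomial (Fin c) Q →+* GenericHypersurface f :=
  Ideal.Quotient.mk _

/-- `r` lies in the degree `d` component of `R`, for the grading induced by `deg x_i = 1` and
`deg q = 0` for `q ∈ Q`. -/
def HasDegree (f : Fin c → Q) (r : GenericHypersurface f) (d : ℤ) : Prop :=
  r = 0 ∨ ∃ (m : ℕ) (p : MvPolynomial (Fin c) Q), (m : ℤ) = d ∧ p.IsHomogeneous m ∧ toR f p = r

/-- The complex `C` over `R` can be graded: each `C n` is a graded free module
`⨁ j, R(-deg n j)` on a finite homogeneous basis such that the differentials are homogeneous.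
It is no restriction that the differentials have degree `0`, as differentials of other degrees
become maps of degree `0` after shifting the gradings. -/
def IsGradedComplex (f : Fin c → Q)
    (C : ChainComplex (ModuleCat.{u} (GenericHypersurface f)) ℤ) : Prop :=
  ∃ (r : ℤ → ℕ) (b : ∀ n, Module.Basis (Fin (r n)) (GenericHypersurface f) (C.X n))
    (deg : ∀ n, Fin (r n) → ℤ),
    ∀ (n : ℤ) (j : Fin (r n)) (i : Fin (r (n - 1))),
      HasDegree f ((b (n - 1)).repr ((C.d n (n - 1)).hom (b n j)) i) (deg n j - deg (n - 1) i)

/-- Objects of the category of graded totally acyclic complexes over `R`. -/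
structure IsGradedTotallyAcyclic (f : Fin c → Q)
    (C : ChainComplex (ModuleCat.{u} (GenericHypersurface f)) ℤ) : Prop where
  totallyAcyclic : IsTotallyAcyclic C
  graded : IsGradedComplex f C

/-- The ring `R_α = R / (x₁ - a₁, …, x_c - a_c)` given by preimages `a_i` of the coordinates. -/
abbrev Specialization (f : Fin c → Q) (a : Fin c → Q) : Type u :=
  GenericHypersurface f ⧸
    Ideal.span (Set.range fun i => toR f (MvPolynomial.X i - MvPolynomial.C (a i)))

variable [IsLocalRing Q]

/-- The projective space `ℙ^{c-1}` over the residue field `k` of `Q`, as a set of points. -/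
abbrev ProjSpace (Q : Type u) [CommRing Q] [IsLocalRing Q] (c : ℕ) : Type u :=
  Projectivization (ResidueField Q) (Fin c → ResidueField Q)

/-- `a` fixes, for every point `α` of `ℙ^{c-1}`, preimages in `Q` of homogeneous coordinates
of `α`. -/
def IsPreimageChoice (a : ProjSpace Q c → Fin c → Q) : Prop :=
  ∀ α, ∃ h : (fun i => residue Q (a α i)) ≠ 0,
    Projectivization.mk (ResidueField Q) (fun i => residue Q (a α i)) h = α

/-- The rank variety `V(C) = {α ∈ ℙ^{c-1} | C_α is not contractible}` with respect to a choice of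
preimages, where `C_α = C ⊗_R R_α`. -/
def rankVariety (f : Fin c → Q) (a : ProjSpace Q c → Fin c → Q)
    (C : ChainComplex (ModuleCat.{u} (GenericHypersurface f)) ℤ) : Set (ProjSpace Q c) :=
  {α | ¬ IsContractible (baseChange (Specialization f (a α)) C)}

/-- The graded `R`-module `R ⊗_Q k = R / 𝔫 R`, that is, `k[x₁, …, x_c]` (when all `f_i` lie in the
maximal ideal `𝔫` of `Q`). -/
abbrev residueModule (f : Fin c → Q) : ModuleCat.{u} (GenericHypersurface f) :=
  ModuleCat.of _ (GenericHypersurface f ⧸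
    (maximalIdeal Q).map (algebraMap Q (GenericHypersurface f)))

end Hypersurface

end RankVariety

end

namespace RankVariety

/-! ### Matrix factorizations -/

/-! Since every `f i` lies in `𝔫²`, the form `w = ∑ f i * x i` is a sum of products of two elements
of `𝔫Q[x]`, so it has a matrix factorization `(φ, ψ)` with entries in `𝔫Q[x]`. As `f 0`, hence `w`,
is a nonzerodivisor, `φ` and `ψ` form a 2-periodic exact complex over `R`. `ExactOff` says that its
homology with coefficients in a module vanishes at one of the two spots after localizing at the
prime `ker θ`; here `θ : R → k` is evaluation at `α`.

If `K_α` were contractible, a lifted homotopy would make a syzygy of `K` locally a direct summand of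
a free module (`ExactOff.ker_of_homotopy`), so this homology would vanish on it. Shifting along the
free resolution (`ExactOff.of_resolution`), it would vanish on `R/𝔫R` too. There both matrices act
as zero, so the homology is not locally zero (`not_exactOff_of_annihilate`). -/

/-- A matrix factorization of `w` with entries in the ideal `I`. -/
def HasMatrixFactorization {S : Type u} [CommRing S] (I : Ideal S) (w : S) : Prop :=
  ∃ (ι : Type) (_ : Fintype ι) (_ : DecidableEq ι) (_ : Nonempty ι) (φ ψ : Matrix ι ι S),
    (∀ i j, φ i j ∈ I) ∧ (∀ i j, ψ i j ∈ I) ∧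
      φ * ψ = w • 1 ∧ ψ * φ = w • 1

section MatrixFactorization

variable {S : Type u} [CommRing S] {I : Ideal S}

theorem hasMatrixFactorization_zero : HasMatrixFactorization I 0 :=
  ⟨Unit, inferInstance, inferInstance, inferInstance, 0, 0, by simp, by simp, by simp, by simp⟩

/-- The block matrices are the tensor product of `(φ, ψ)` with the 1×1 factorization `(y, z)` of `y
* z`. -/
theorem HasMatrixFactorization.add_mul {w y z : S} (h : HasMatrixFactorization I w)
    (hy : y ∈ I) (hz : z ∈ I) : HasMatrixFactorization I (w + y * z) := by
  obtain ⟨ι, _, _, _, φ, ψ, hφ, hψ, h₁, h₂⟩ := h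
  refine ⟨ι ⊕ ι, inferInstance, inferInstance, inferInstance,
    Matrix.fromBlocks φ (-(y • 1)) (z • 1) ψ, Matrix.fromBlocks ψ (y • 1) (-(z • 1)) φ,
    ?_, ?_, ?_, ?_⟩
  · rintro (i | i) (j | j)
    · simpa using hφ i j
    · by_cases h : i = j <;> simp [h, hy]
    · by_cases h : i = j <;> simp [h, hz]
    · simpa using hψ i j
  · rintro (i | i) (j | j)
    · simpa using hψ i j
    · by_cases h : i = j <;> simp [h, hy]
    · by_cases h : i = j <;> simp [h, hz]
    · simpa using hφ i j
  all_goals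
    rw [Matrix.fromBlocks_multiply, h₁, h₂, ← Matrix.fromBlocks_one, Matrix.fromBlocks_smul]
    simp [add_smul, smul_smul, mul_comm z y, add_comm]

theorem hasMatrixFactorization_of_mem_sq {w : S} (hw : w ∈ I ^ 2) :
    HasMatrixFactorization I w := by
  -- Only single products can be absorbed, so the induction over sums runs from an arbitrary start
  -- `u`.
  suffices h : ∀ u, HasMatrixFactorization I u → HasMatrixFactorization I (u + w) by
    simpa using h 0 hasMatrixFactorization_zero
  rw [pow_two] at hw
  induction hw using Submodule.mul_induction_on' with
  | mem_mul_mem y hy z hz => exact fun u hu => hu.add_mul hy hz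
  | add x _ y _ hx hy => exact fun u hu => by simpa [add_assoc] using hy _ (hx u hu)

end MatrixFactorization

/-! ### Matrices acting on tuples of module elements -/

section MatrixAction

variable {R : Type u} [CommRing R] {ι : Type} [Fintype ι]

/-- The action of a square matrix on tuples of elements of a module. -/
def matAct (φ : Matrix ι ι R) {L : Type*} [AddCommGroup L] [Module R L] :
    (ι → L) →ₗ[R] (ι → L) :=
  LinearMap.pi fun i => ∑ j, φ i j • LinearMap.proj j

variable {L P : Type*} [AddCommGroup L] [Module R L] [AddCommGroup P] [Module R P]

theorem matAct_apply (φ : Matrix ι ι R) (v : ι → L) (i : ι) :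
    matAct φ v i = ∑ j, φ i j • v j := by
  simp [matAct]

theorem matAct_comp_linearMap (φ : Matrix ι ι R) (g : L →ₗ[R] P) (v : ι → L) :
    matAct φ (fun i => g (v i)) = fun i => g (matAct φ v i) := by
  ext i
  simp [matAct_apply]

theorem matAct_matAct (φ ψ : Matrix ι ι R) (v : ι → L) :
    matAct φ (matAct ψ v) = matAct (φ * ψ) v := by
  ext i
  simp only [matAct_apply, Matrix.mul_apply, Finset.smul_sum, Finset.sum_smul, smul_smul]
  exact Finset.sum_comm

@[simp]
theorem matAct_zero (v : ι → L) : matAct (0 : Matrix ι ι R) v = 0 := by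
  ext i
  simp [matAct_apply]

/-- The sequence `φ`, `ψ` of matrices is exact on the module `L`, up to multiplication by elements
outside of the kernel of `θ`. -/
def ExactOff {k : Type*} [Field k] (θ : R →+* k) (φ ψ : Matrix ι ι R)
    (L : Type*) [AddCommGroup L] [Module R L] : Prop :=
  ∀ v : ι → L, matAct φ v = 0 → ∃ t : R, θ t ≠ 0 ∧ ∃ w : ι → L, matAct ψ w = t • v

variable {k : Type*} [Field k] {θ : R →+* k} {φ ψ : Matrix ι ι R}

theorem exactOff_of_free [Module.Free R P] [DecidableEq ι]
    (h : Function.Exact (Matrix.toLin' ψ) (Matrix.toLin' φ)) : ExactOff θ φ ψ P := by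
  -- Under `P ⊗ R^ι ≅ P^ι` the action of `A` is `P ⊗ A`, so flatness of `P` gives exactness, with `t
  -- = 1`.
  have key : ∀ (A : Matrix ι ι R) (x : P ⊗[R] (ι → R)),
      TensorProduct.piScalarRight R R P ι ((Matrix.toLin' A).lTensor P x) =
        matAct A (TensorProduct.piScalarRight R R P ι x) := by
    intro A x
    induction x with
    | zero => simp
    | add x y hx hy => simp only [map_add, hx, hy]
    | tmul p y =>
      ext i
      simp [matAct_apply, Matrix.mulVec, dotProduct, Finset.sum_smul, smul_smul]
  intro v hv
  have hex := Module.Flat.lTensor_exact P h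
  obtain ⟨x, rfl⟩ := (TensorProduct.piScalarRight R R P ι).surjective v
  rw [← key, LinearEquiv.map_eq_zero_iff] at hv
  obtain ⟨y, rfl⟩ := (hex x).1 hv
  exact ⟨1, by simp, _, by rw [← key, one_smul]⟩

/-- Two-out-of-three for short exact sequences `0 → Z → P → L → 0`. -/
theorem ExactOff.of_shortExact {Z : Submodule R P} {π : P →ₗ[R] L} (hπ : Function.Surjective π)
    (hZ : LinearMap.ker π = Z) (h : ψ * φ = 0)
    (hP : ExactOff θ φ ψ P) (hL : ExactOff θ ψ φ Z) : ExactOff θ φ ψ L := by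
  subst hZ
  intro v hv
  choose p hp using fun i => hπ (v i)
  have hker : ∀ i, matAct φ p i ∈ LinearMap.ker π := fun i => by
    have := congrFun (matAct_comp_linearMap φ π p) i
    rw [LinearMap.mem_ker, ← this, show (fun i => π (p i)) = v from funext hp, hv]
    rfl
  have hsub : ∀ (A : Matrix ι ι R) (z : ι → LinearMap.ker π) (i : ι),
      matAct A (fun i => (z i : P)) i = ((matAct A z i : LinearMap.ker π) : P) := fun A z i =>
    congrFun (matAct_comp_linearMap A (LinearMap.ker π).subtype z) i
  -- The connecting map: `φ p` is a cycle for `ψ` in the kernel. Writing `t • φ p = φ z` makes `t •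
  -- p - z` a cycle for `φ` in `P`.
  obtain ⟨t, ht, z, hz⟩ := hL (fun i => ⟨matAct φ p i, hker i⟩) (by
    ext i
    rw [← hsub]
    change matAct ψ (matAct φ p) i = _
    simp [matAct_matAct, h])
  obtain ⟨t', ht', q, hq⟩ := hP (t • p - fun i => (z i : P)) (by
    ext i
    rw [map_sub, map_smul, Pi.sub_apply, hsub, hz]
    simp)
  refine ⟨t' * t, by simp [ht, ht'], fun i => π (q i), ?_⟩
  rw [matAct_comp_linearMap, hq]
  ext i
  simp [hp, mul_smul]

/-- Modules through which multiplication by an element outside of `ker θ` factors. -/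
theorem ExactOff.of_factor {α : L →ₗ[R] P} {β : P →ₗ[R] L} {t : R} (ht : θ t ≠ 0)
    (h : ∀ x, β (α x) = t • x) (hP : ExactOff θ φ ψ P) : ExactOff θ φ ψ L := by
  intro v hv
  obtain ⟨t', ht', w, hw⟩ := hP (fun i => α (v i)) (by
    rw [matAct_comp_linearMap, hv]
    ext i
    simp)
  refine ⟨t' * t, by simp [ht, ht'], fun i => β (w i), ?_⟩
  rw [matAct_comp_linearMap, hw]
  ext i
  simp [h, mul_smul]

theorem not_exactOff_of_annihilate [Nonempty ι] {I : Ideal R} (hφ : ∀ i j, φ i j ∈ I)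
    (hψ : ∀ i j, ψ i j ∈ I) (hI : ∀ x ∈ I, θ x = 0) : ¬ ExactOff θ φ ψ (R ⧸ I) := by
  have h0 : ∀ (A : Matrix ι ι R), (∀ i j, A i j ∈ I) → ∀ v : ι → R ⧸ I, matAct A v = 0 := by
    intro A hA v
    ext i
    rw [matAct_apply]
    refine Finset.sum_eq_zero fun j _ => ?_
    rw [Algebra.smul_def, Ideal.Quotient.algebraMap_eq, Ideal.Quotient.eq_zero_iff_mem.2 (hA i j),
      zero_mul]
  intro h
  -- The constant tuple `1` is a cycle and only `0` is a boundary, so `t` would lie in `I`.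
  obtain ⟨t, ht, w, hw⟩ := h 1 (h0 φ hφ _)
  rw [h0 ψ hψ] at hw
  refine ht (hI t ?_)
  have := congrFun hw (Classical.arbitrary ι)
  simpa [Algebra.smul_def, ← Ideal.Quotient.eq_zero_iff_mem] using this.symm

end MatrixAction

section Quotient

variable {S : Type u} [CommRing S]

/-- Modulo a nonzerodivisor `w`, a matrix factorization of `w` gives an exact sequence. -/
theorem exact_of_matrixFactorization {w : S} (hw : ∀ x, w * x = 0 → x = 0) {ι : Type} [Fintype ι]
    [DecidableEq ι] {φ ψ : Matrix ι ι S} (h₁ : φ * ψ = w • 1) (h₂ : ψ * φ = w • 1) :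
    Function.Exact (Matrix.toLin' (ψ.map (Ideal.Quotient.mk (Ideal.span {w}))))
      (Matrix.toLin' (φ.map (Ideal.Quotient.mk (Ideal.span {w})))) := by
  set q := Ideal.Quotient.mk (Ideal.span {w})
  have hq : ∀ x, q x = 0 ↔ ∃ y, x = w * y := fun x => by
    rw [Ideal.Quotient.eq_zero_iff_mem, Ideal.mem_span_singleton]
    rfl
  have hmap : ∀ (A : Matrix ι ι S) (v : ι → S), (A.map q).mulVec (q ∘ v) = q ∘ A.mulVec v := by
    intro A v
    ext i
    simp [Matrix.mulVec, dotProduct]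
  intro v
  choose v' hv' using fun i => Ideal.Quotient.mk_surjective (I := Ideal.span {w}) (v i)
  obtain rfl : q ∘ v' = v := funext hv'
  simp only [Matrix.toLin'_apply, Set.mem_range]
  constructor
  · intro hv
    rw [hmap] at hv
    choose b hb using fun i => (hq _).1 (congrFun hv i)
    refine ⟨q ∘ b, ?_⟩
    rw [hmap]
    congr 1
    -- From `φ v' = w b` follows `w v' = ψ φ v' = w ψ b`; then `w` is cancelled.
    have h : ψ.mulVec (φ.mulVec v') = w • ψ.mulVec b := by
      rw [← Matrix.mulVec_smul]
      congr 1
      ext i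
      exact hb i
    rw [Matrix.mulVec_mulVec, h₂, Matrix.smul_mulVec, Matrix.one_mulVec] at h
    ext i
    have hi := congrFun h i
    simp only [Pi.smul_apply, smul_eq_mul] at hi
    exact (sub_eq_zero.1 (hw _ (by rw [mul_sub, hi, sub_self]))).symm
  · rintro ⟨y, hy⟩
    rw [← hy, Matrix.mulVec_mulVec, ← Matrix.map_mul, h₁]
    have : (w • (1 : Matrix ι ι S)).map q = 0 := by
      ext i j
      exact (hq _).2 ⟨_, rfl⟩
    rw [this, Matrix.zero_mulVec]

end Quotient

/-! ### The form as a nonzerodivisor in the square of an ideal -/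

section Hypersurface

variable {Q : Type u} [CommRing Q] {c : ℕ}

/-- The form `f₁ x₁ + ⋯ + f_c x_c` is a nonzerodivisor if `f₁` is. -/
theorem form_mul_eq_zero (f : Fin (c + 1) → Q) (hf : ∀ x, f 0 * x = 0 → x = 0)
    (p : MvPolynomial (Fin (c + 1)) Q) (hp : form f * p = 0) : p = 0 := by
  nontriviality Q
  have hf0 : f 0 ≠ 0 := fun h => one_ne_zero (hf 1 (by rw [h, zero_mul]))
  have hC : (MvPolynomial.C (f 0) : MvPolynomial (Fin c) Q) ∈ nonZeroDivisors _ := by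
    rw [mem_nonZeroDivisors_iff_right]
    intro x hx
    ext m
    refine hf _ ?_
    rw [← MvPolynomial.coeff_C_mul, mul_comm, hx, MvPolynomial.coeff_zero]
  -- As a polynomial in the first variable, the form is linear with leading coefficient `f 0`.
  have hform : MvPolynomial.finSuccEquiv Q c (form f) =
      Polynomial.C (MvPolynomial.C (f 0)) * Polynomial.X +
        Polynomial.C (∑ i : Fin c, MvPolynomial.C (f i.succ) * MvPolynomial.X i) := by
    simp [form, Fin.sum_univ_succ, MvPolynomial.finSuccEquiv_apply]
  have hne : (MvPolynomial.C (f 0) : MvPolynomial (Fin c) Q) ≠ 0 := by simpa using hf0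
  have hreg : MvPolynomial.finSuccEquiv Q c (form f) ∈ nonZeroDivisors _ := by
    refine Polynomial.mem_nonZeroDivisors_of_leadingCoeff ?_
    rwa [hform, Polynomial.leadingCoeff_linear hne]
  have h0 : MvPolynomial.finSuccEquiv Q c p = 0 := by
    refine (mem_nonZeroDivisors_iff_right.1 hreg) _ ?_
    rw [← map_mul, mul_comm, hp, map_zero]
  simpa using h0

theorem form_mem_sq (f : Fin c → Q) {I : Ideal Q} (hf : ∀ i, f i ∈ I ^ 2) :
    form f ∈ (I.map (MvPolynomial.C : Q →+* MvPolynomial (Fin c) Q)) ^ 2 := by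
  rw [← Ideal.map_pow]
  exact Ideal.sum_mem _ fun i _ => Ideal.mul_mem_right _ _ (Ideal.mem_map_of_mem _ (hf i))

end Hypersurface

/-! ### Contractibility, syzygies and dimension shifting -/

section Syzygies

variable {R : Type u} [CommRing R] {ι : Type} [Fintype ι] {k : Type*} [Field k] {θ : R →+* k}
  {φ ψ : Matrix ι ι R}

/-- Carries Cayley–Hamilton from a free module to a submodule of cycles, which need not be free. -/
theorem aeval_apply_of_comp_subtype {P : Type*} [AddCommGroup P] [Module R P]
    {Z : Submodule R P} (u : Module.End R P) (u' : Module.End R Z)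
    (h : ∀ z : Z, ((u' z : Z) : P) = u z) (p : Polynomial R) (z : Z) :
    ((Polynomial.aeval u' p z : Z) : P) = Polynomial.aeval u p z := by
  induction p using Polynomial.induction_on generalizing z with
  | C a => simp [Module.algebraMap_end_apply]
  | add p q hp hq => simp [hp, hq]
  | monomial n a hn =>
    rw [pow_succ, ← mul_assoc, map_mul, map_mul (Polynomial.aeval u) (_ * _), Polynomial.aeval_X,
      Polynomial.aeval_X, Module.End.mul_apply, Module.End.mul_apply, ← h, ← hn]

/-- If `∂ s + s ∂` is invertible modulo `ker θ` at a free module `P`, then multiplication by an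
element outside of `ker θ` on `ker ∂` factors through the next free module. -/
theorem ExactOff.ker_of_homotopy {P P₁ P₂ : Type*} [AddCommGroup P] [Module R P]
    [AddCommGroup P₁] [Module R P₁] [AddCommGroup P₂] [Module R P₂] [Module.Free R P]
    [Module.Finite R P] {d₁ : P₁ →ₗ[R] P} {d : P →ₗ[R] P₂} (hd : d ∘ₗ d₁ = 0)
    (s : P →ₗ[R] P₁) (s' : P₂ →ₗ[R] P) (hdet : θ (LinearMap.det (d₁ ∘ₗ s + s' ∘ₗ d)) ≠ 0)
    (hP : ExactOff θ φ ψ P₁) : ExactOff θ φ ψ (LinearMap.ker d) := by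
  set u : Module.End R P := d₁ ∘ₗ s + s' ∘ₗ d with hu
  let β : P₁ →ₗ[R] LinearMap.ker d :=
    d₁.codRestrict _ fun x => LinearMap.congr_fun hd x
  let α : LinearMap.ker d →ₗ[R] P₁ := s ∘ₗ (LinearMap.ker d).subtype
  have hu' : ∀ z : LinearMap.ker d, (((β ∘ₗ α) z : LinearMap.ker d) : P) = u z := by
    rintro ⟨z, hz⟩
    have : d z = 0 := hz
    simp [hu, this, α, β]
    rfl
  have hcoeff : θ (u.charpoly.coeff 0) ≠ 0 := by
    intro h
    rw [LinearMap.det_eq_sign_charpoly_coeff, map_mul, h, mul_zero] at hdet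
    exact hdet rfl
  -- On cycles `u` restricts to `β ∘ α`. With `χ = X * divX χ + χ(0)`, Cayley–Hamilton reads `χ(0) =
  -- -(divX χ)(βα) ∘ β ∘ α`, and `χ(0) = ± det u`.
  refine ExactOff.of_factor (α := α)
    (β := -((Polynomial.aeval (β ∘ₗ α) u.charpoly.divX : Module.End R (LinearMap.ker d)) ∘ₗ β))
    hcoeff (fun z => ?_) hP
  have h0 : Polynomial.aeval (β ∘ₗ α : Module.End R (LinearMap.ker d)) u.charpoly z = 0 := by
    ext
    rw [aeval_apply_of_comp_subtype u _ hu', LinearMap.aeval_self_charpoly]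
    rfl
  rw [← Polynomial.divX_mul_X_add u.charpoly, map_add, map_mul, Polynomial.aeval_X,
    Polynomial.aeval_C, LinearMap.add_apply, Module.algebraMap_end_apply] at h0
  exact neg_eq_of_add_eq_zero_right h0

/-- Linear maps between free modules lift along surjective base changes. -/
theorem exists_lift_of_baseChange {A : Type*} [CommRing A] [Algebra R A]
    (hA : Function.Surjective (algebraMap R A)) {P P' : Type*} [AddCommGroup P] [Module R P]
    [AddCommGroup P'] [Module R P'] [Module.Free R P] (s : A ⊗[R] P →ₗ[A] A ⊗[R] P') :
    ∃ σ : P →ₗ[R] P', σ.baseChange A = s := by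
  have hsurj : Function.Surjective (TensorProduct.mk R A P' 1) := by
    intro x
    induction x with
    | zero => exact ⟨0, by simp⟩
    | add x y hx hy =>
      obtain ⟨x, rfl⟩ := hx
      obtain ⟨y, rfl⟩ := hy
      exact ⟨x + y, map_add _ _ _⟩
    | tmul a p =>
      obtain ⟨r, rfl⟩ := hA a
      exact ⟨r • p, by simp [Algebra.algebraMap_eq_smul_one, TensorProduct.smul_tmul]⟩
  obtain ⟨σ, hσ⟩ := Module.projective_lifting_property (TensorProduct.mk R A P' 1)
    (s.restrictScalars R ∘ₗ TensorProduct.mk R A P 1) hsurj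
  refine ⟨σ, ?_⟩
  ext x
  simpa using LinearMap.congr_fun hσ x

/-- The homotopy lifts from `A` to `R`. The determinant of the lifted `∂σ + σ'∂` becomes a unit in
`A`, so `θ`, which factors through `A`, does not kill it. -/
theorem exactOff_ker_of_isContractible {A : Type u} [CommRing A] [Algebra R A]
    (hA : Function.Surjective (algebraMap R A)) (τ : A →+* k)
    (hτ : ∀ r, τ (algebraMap R A r) = θ r) {C : ChainComplex (ModuleCat.{u} R) ℤ}
    (hC : IsTotallyAcyclic C) (hcon : IsContractible (baseChange A C))
    (hfree : ∀ n, ExactOff θ φ ψ (C.X n)) (m p : ℤ) (hp : p = m - 1) :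
    ExactOff θ φ ψ (LinearMap.ker (C.d m p).hom) := by
  subst hp
  have := hC.free
  have := hC.finite
  obtain ⟨s, hs⟩ := hcon
  obtain ⟨σ, hσ⟩ := exists_lift_of_baseChange hA (s m (m + 1))
  obtain ⟨σ', hσ'⟩ := exists_lift_of_baseChange hA (s (m - 1) m)
  refine ExactOff.ker_of_homotopy (d₁ := (C.d (m + 1) m).hom) ?_ σ σ' ?_ (hfree (m + 1))
  · rw [← ModuleCat.hom_comp, C.d_comp_d]
    rfl
  · rw [← hτ, ← LinearMap.det_baseChange]
    refine (IsUnit.map τ ?_).ne_zero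
    rw [LinearMap.baseChange_add, LinearMap.baseChange_comp, LinearMap.baseChange_comp, hσ, hσ']
    exact LinearEquiv.isUnit_det' (LinearEquiv.ofBijective _ (hs m))

theorem ExactOff.congr {L L' : Type*} [AddCommGroup L] [Module R L] [AddCommGroup L']
    [Module R L'] (e : L ≃ₗ[R] L') (h : ExactOff θ φ ψ L') : ExactOff θ φ ψ L :=
  ExactOff.of_factor (α := e.toLinearMap) (β := e.symm.toLinearMap) (t := 1) (by simp) (by simp) h

/-- If a high syzygy in a free resolution of `M` is exact off `ker θ`, then so is `M`. -/
theorem ExactOff.of_resolution {M : ModuleCat.{u} R} (F : ProjectiveResolution M)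
    (h₁ : φ * ψ = 0) (h₂ : ψ * φ = 0) (hF : ∀ n, ExactOff θ φ ψ (F.complex.X n))
    (hF' : ∀ n, ExactOff θ ψ φ (F.complex.X n)) (n : ℕ)
    (hZ : ExactOff θ φ ψ (LinearMap.ker (F.complex.d (n + 1) n).hom))
    (hZ' : ExactOff θ ψ φ (LinearMap.ker (F.complex.d (n + 1) n).hom)) : ExactOff θ φ ψ M := by
  have step : ∀ {P₂ P₁ P₀ : ModuleCat.{u} R} {f : P₂ ⟶ P₁} {g : P₁ ⟶ P₀} (w : f ≫ g = 0),
      (ShortComplex.mk f g w).Exact → ∃ π : P₂ →ₗ[R] LinearMap.ker g.hom,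
        Function.Surjective π ∧ LinearMap.ker π = LinearMap.ker f.hom := by
    intro P₂ P₁ P₀ f g w h
    rw [ShortComplex.moduleCat_exact_iff] at h
    refine ⟨f.hom.codRestrict _ fun x => ?_, ?_, LinearMap.ker_codRestrict _ _ _⟩
    · exact congrArg (fun a => a.hom x) w
    · rintro ⟨y, hy⟩
      obtain ⟨x, hx⟩ := h y hy
      exact ⟨x, Subtype.ext hx⟩
  -- Each short exact sequence swaps `φ` and `ψ`, so both orders are carried along.
  induction n with
  | zero =>
    obtain ⟨π, hπ, hker⟩ := step _ F.exact₀
    have hepi : Function.Surjective (F.π.f 0).hom := (ModuleCat.epi_iff_surjective _).1 inferInstance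
    exact ExactOff.of_shortExact (L := M) hepi rfl h₂ (hF 0)
      (ExactOff.of_shortExact hπ hker h₁ (hF' 1) hZ)
  | succ n ih =>
    obtain ⟨π, hπ, hker⟩ := step _ (F.exact_succ n)
    exact ih (ExactOff.of_shortExact hπ hker h₂ (hF _) hZ')
      (ExactOff.of_shortExact hπ hker h₁ (hF' _) hZ)

/-- A complex whose base change is contractible is not a complete resolution of a module which
is annihilated by the entries of an exact pair of matrices. -/
theorem IsCompleteResolution.not_isContractible [DecidableEq ι] [Nonempty ι]
    (h₁ : Function.Exact (Matrix.toLin' ψ) (Matrix.toLin' φ))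
    (h₂ : Function.Exact (Matrix.toLin' φ) (Matrix.toLin' ψ)) {I : Ideal R}
    (hφ : ∀ i j, φ i j ∈ I) (hψ : ∀ i j, ψ i j ∈ I) (hI : ∀ x ∈ I, θ x = 0)
    {A : Type u} [CommRing A] [Algebra R A] (hA : Function.Surjective (algebraMap R A))
    (τ : A →+* k) (hτ : ∀ r, τ (algebraMap R A r) = θ r) {C : ChainComplex (ModuleCat.{u} R) ℤ}
    (hC : IsCompleteResolution C (ModuleCat.of R (R ⧸ I))) : ¬ IsContractible (baseChange A C) := by
  intro hcon
  obtain ⟨hC, F, hF, i, e, he⟩ := hC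
  have hfree := hC.free
  have hmul : ∀ {A B : Matrix ι ι R}, Function.Exact (Matrix.toLin' B) (Matrix.toLin' A) →
      A * B = 0 := fun h =>
    Matrix.toLin'.injective (by rw [Matrix.toLin'_mul, h.linearMap_comp_eq_zero, map_zero])
  -- From degree `i` on `F` and `C` agree, so their cycles in degree `i + 1` correspond.
  have hker : LinearMap.ker (F.complex.d (i + 1) i).hom =
      (LinearMap.ker (C.d ((i + 1 : ℕ) : ℤ) (i : ℤ)).hom).comap
        (e (i + 1) i.le_succ).toLinearEquiv.toLinearMap := by
    ext x
    have := congrArg (fun a => a.hom x) (he i le_rfl)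
    change C.d _ _ ((e (i + 1) _).hom x) = (e i _).hom (F.complex.d _ _ x) at this
    change F.complex.d _ _ x = 0 ↔ C.d _ _ ((e (i + 1) _).hom x) = 0
    rw [this]
    exact ((e i le_rfl).toLinearEquiv.map_eq_zero_iff).symm
  have eqv : LinearMap.ker (F.complex.d (i + 1) i).hom ≃ₗ[R]
      LinearMap.ker (C.d ((i + 1 : ℕ) : ℤ) (i : ℤ)).hom :=
    (LinearEquiv.ofEq _ _ hker).trans
      ((e (i + 1) i.le_succ).toLinearEquiv.ofSubmodule' _)
  refine not_exactOff_of_annihilate hφ hψ hI (ExactOff.of_resolution F (hmul h₁) (hmul h₂)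
    (fun n => exactOff_of_free h₁) (fun n => exactOff_of_free h₂) i ?_ ?_)
  · exact (exactOff_ker_of_isContractible hA τ hτ hC hcon (fun n => exactOff_of_free h₁) _ _
      (by push_cast; ring)).congr eqv
  · exact (exactOff_ker_of_isContractible hA τ hτ hC hcon (fun n => exactOff_of_free h₂) _ _
      (by push_cast; ring)).congr eqv

end Syzygies

/-! ### Evaluation at a point of projective space -/

section Evaluation

variable {Q : Type u} [CommRing Q] [IsLocalRing Q] {c : ℕ}

/-- The point of `R` with values in the residue field given by `x_i ↦ a_i`. -/
noncomputable def residueEval (f : Fin c → Q) (hf : ∀ i, f i ∈ maximalIdeal Q) (a : Fin c → Q) :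
    GenericHypersurface f →+* ResidueField Q :=
  Ideal.Quotient.lift _ (MvPolynomial.eval₂Hom (residue Q) fun i => residue Q (a i)) fun p hp => by
    rw [← RingHom.mem_ker]
    revert p
    change Ideal.span {form f} ≤ _
    rw [Ideal.span_singleton_le_iff_mem, RingHom.mem_ker]
    simp [form, (residue_eq_zero_iff _).2 (hf _)]

theorem residueEval_toR (f : Fin c → Q) (hf : ∀ i, f i ∈ maximalIdeal Q) (a : Fin c → Q)
    (p : MvPolynomial (Fin c) Q) : residueEval f hf a (toR f p) =
      MvPolynomial.eval₂Hom (residue Q) (fun i => residue Q (a i)) p :=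
  Ideal.Quotient.lift_mk _ _ _

/-- The map from the specialization at `a` to the residue field. -/
noncomputable def specializationResidue (f : Fin c → Q) (hf : ∀ i, f i ∈ maximalIdeal Q)
    (a : Fin c → Q) : Specialization f a →+* ResidueField Q :=
  Ideal.Quotient.lift _ (residueEval f hf a) fun p hp => by
    rw [← RingHom.mem_ker]
    revert p
    change Ideal.span _ ≤ _
    rw [Ideal.span_le]
    rintro _ ⟨i, rfl⟩
    rw [SetLike.mem_coe, RingHom.mem_ker, residueEval_toR]
    simp

theorem residueEval_eq_zero (f : Fin c → Q) (hf : ∀ i, f i ∈ maximalIdeal Q) (a : Fin c → Q)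
    {x : GenericHypersurface f}
    (hx : x ∈ (maximalIdeal Q).map (algebraMap Q (GenericHypersurface f))) :
    residueEval f hf a x = 0 := by
  rw [← RingHom.mem_ker]
  revert x
  change Ideal.map _ _ ≤ _
  rw [Ideal.map_le_iff_le_comap]
  intro q hq
  rw [Ideal.mem_comap, RingHom.mem_ker]
  change residueEval f hf a (toR f (MvPolynomial.C q)) = 0
  rw [residueEval_toR]
  simpa using hq

end Evaluation

end RankVariety

theorem mainTheorem10 {Q : Type u} [CommRing Q] [IsRegularLocalRing Q]
    {c : ℕ} (hc : 2 ≤ c) (f : Fin c → Q)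
    (hreg : RingTheory.Sequence.IsRegular Q (List.ofFn f))
    (hsq : ∀ i, f i ∈ maximalIdeal Q ^ 2)
    (a : RankVariety.ProjSpace Q c → Fin c → Q) (ha : RankVariety.IsPreimageChoice a)
    (K : ChainComplex (ModuleCat.{u} (RankVariety.GenericHypersurface f)) ℤ)
    (hK : RankVariety.IsGradedTotallyAcyclic f K)
    (hres : RankVariety.IsCompleteResolution K (RankVariety.residueModule f)) :
    RankVariety.rankVariety f a K = Set.univ := by
  have hf : ∀ i, f i ∈ maximalIdeal Q := fun i => Ideal.pow_le_self two_ne_zero (hsq i)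
  obtain ⟨c, rfl⟩ : ∃ n, c = n + 1 := ⟨c - 1, by omega⟩
  have hf0 : ∀ x, f 0 * x = 0 → x = 0 := by
    rw [List.ofFn_succ, RingTheory.Sequence.isRegular_cons_iff] at hreg
    exact fun x hx => hreg.1.right_eq_zero_of_smul hx
  obtain ⟨ι, _, _, _, φ, ψ, hφ, hψ, h₁, h₂⟩ :=
    RankVariety.hasMatrixFactorization_of_mem_sq (RankVariety.form_mem_sq f hsq)
  have hmem : ∀ {x : MvPolynomial (Fin (c + 1)) Q},
      x ∈ (maximalIdeal Q).map (MvPolynomial.C : Q →+* MvPolynomial (Fin (c + 1)) Q) →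
      RankVariety.toR f x ∈
        (maximalIdeal Q).map (algebraMap Q (RankVariety.GenericHypersurface f)) := fun hx => by
    have := Ideal.mem_map_of_mem (RankVariety.toR f) hx
    rwa [Ideal.map_map] at this
  have hw := RankVariety.form_mul_eq_zero f hf0
  rw [Set.eq_univ_iff_forall]
  intro α
  exact RankVariety.IsCompleteResolution.not_isContractible
    (RankVariety.exact_of_matrixFactorization hw h₁ h₂)
    (RankVariety.exact_of_matrixFactorization hw h₂ h₁)
    (fun i j => hmem (hφ i j)) (fun i j => hmem (hψ i j))
    (fun x hx => RankVariety.residueEval_eq_zero f hf (a α) hx)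
    Ideal.Quotient.mk_surjective (RankVariety.specializationResidue f hf (a α))
    (fun r => Ideal.Quotient.lift_mk _ _ _) hres
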